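/- All graphs are simple. For a locally finite graph $G$, a vertex $v$ and an integer $r\ge 0$, let $B_r(G,v)$ be the subgraph of $G$ induced on the vertices at distance at most $r$ from $v$, rooted at $v$. Let $\mathcal G_*$ be the space of connected locally finite rooted graphs up to root-preserving isomorphism $\cong$, with the Borel $\sigma$-algebra of the metric $$d_{loc}(G_1,G_2)=2^{-\sup\{r:\,B_r(G_1)\cong B_r(G_2)\}} .$$ Let $(G_n)_{n\ge1}$ be random graphs whose numbers of vertices $|V(G_n)|\ge 3$ are non-random with $|V(G_n)|\to\infty$, and let $G^*$ be a random element of $\mathcal G_*$ with root $r^*$. Suppose that $G_n$ converges locally weakly in probability to $G^*$: for every integer $r\ge0$ and every finite $H\in\mathcal G_*$, $$\frac{|\{v\in V(G_n): B_r(G_n,v)\cong H\}|}{|V(G_n)|}\ \xrightarrow{p}\ \mathbb P\big(B_r(G^*)\cong H\big).$$ Let $d_n$ be the degree in $G_n$ of a vertex chosen uniformly at random from $V(G_n)$ (given $G_n$), let $d^*$ be the degree of $r^*$ in $G^*$, and write $(x)_2=x(x-1)$. Suppose that $$\mathbb E\,d_n^2\to\mathbb E\,(d^*)^2\in(0,\infty)\qquad\text{and}\qquad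 \mathbb E\,(d^*)_2\neq 0 .$$ For graphs $H,G$ let $\mathrm{emb}(H,G)$ be the number of embeddings (injective homomorphisms) of $H$ into $G$, and for a rooted graph $H'$ let $\mathrm{emb}'(H',G,v)$ be the number of embeddings of $H'$ into $G$ that map the root of $H'$ to $v$. Let $K_3$ be the triangle and $K_3'$ the triangle rooted at any vertex, $P_3$ the path on three vertices, and $K_{1,2}'$ the star with two leaves rooted at its vertex of degree two. The clustering coefficient of a finite graph $G$ is $\alpha(G)=\mathrm{emb}(K_3,G)/\mathrm{emb}(P_3,G)$, and $\alpha(G)=0$ if the denominator is zero. Then $\mathbb E\,\mathrm{emb}'(K_3',G^*,r^*)$, $\mathbb E\,\mathrm{emb}'(K_{1,2}',G^*,r^*)$ and $\mathbb E\,(d^*)_2$ are finite, and $$\alpha(G_n)\ \xrightarrow{p}\ \alpha^*:=\frac{\mathbb E\,\mathrm{emb}'(K_3',G^*,r^*)}{\mathbb E\,\mathrm{emb}'(K_{1,2}',G^*,r^*)}=\frac{\mathbb E\,\mathrm{emb}'(K_3',G^*,r^*)}{\mathbb E\,(d^*)_2}.$$ -/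

import Mathlib

open Filter Topology MeasureTheory ProbabilityTheory

namespace LocalWeak

/-! ### Counting functions on rooted graphs -/

/-- The degree of the vertex `v` in a (locally finite) graph `G`. -/
noncomputable def deg {V : Type*} (G : SimpleGraph V) (v : V) : ℕ :=
  (G.neighborSet v).ncard

/-- The number of embeddings (injective homomorphisms) from `H` to `G` that map the root `w` of `H`
to `v`. -/
noncomputable def embRooted {W V : Type*} (H : SimpleGraph W) (w : W) (G : SimpleGraph V) (v : V) :
    ℕ :=
  Nat.card {f : SimpleGraph.Copy H G // f w = v}

/-! ### The space of rooted connected locally finite graphs -/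

/-- A rooted connected locally finite graph. -/
structure RootedGraph : Type 1 where
  V : Type
  graph : SimpleGraph V
  root : V
  connected : graph.Connected
  locallyFinite : ∀ v, (graph.neighborSet v).Finite

/-- Root-preserving graph isomorphism. -/
def RootedIso {V W : Type*} (G : SimpleGraph V) (v : V) (H : SimpleGraph W) (w : W) : Prop :=
  ∃ φ : G ≃g H, φ v = w

theorem RootedIso.refl {V : Type*} (G : SimpleGraph V) (v : V) : RootedIso G v G v :=
  ⟨SimpleGraph.Iso.refl, rfl⟩

theorem RootedIso.symm {V W : Type*} {G : SimpleGraph V} {v : V} {H : SimpleGraph W} {w : W}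
    (h : RootedIso G v H w) : RootedIso H w G v := by
  obtain ⟨φ, rfl⟩ := h
  exact ⟨φ.symm, φ.symm_apply_apply v⟩

theorem RootedIso.trans {V W X : Type*} {G : SimpleGraph V} {v : V} {H : SimpleGraph W} {w : W}
    {K : SimpleGraph X} {x : X} (h : RootedIso G v H w) (h2 : RootedIso H w K x) :
    RootedIso G v K x := by
  obtain ⟨φ, rfl⟩ := h
  obtain ⟨ψ, rfl⟩ := h2
  exact ⟨ψ.comp φ, rfl⟩

instance rootedGraphSetoid : Setoid RootedGraph where
  r G H := RootedIso G.graph G.root H.graph H.root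
  iseqv := ⟨fun _ => RootedIso.refl _ _, RootedIso.symm, RootedIso.trans⟩

/-- The space of rooted connected locally finite graphs up to root-preserving isomorphism. Such
graphs are countable, so vertex sets in `Type` lose nothing. -/
def GStar : Type 1 := Quotient rootedGraphSetoid

/-! ### Balls -/

/-- The set of vertices of `G` at distance at most `r` from `v`. -/
def ballSet {V : Type*} (G : SimpleGraph V) (v : V) (r : ℕ) : Set V :=
  {u | G.edist v u ≤ r}

theorem self_mem_ballSet {V : Type*} (G : SimpleGraph V) (v : V) (r : ℕ) : v ∈ ballSet G v r := by
  simp [ballSet]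

theorem ballSet_induce_reachable {V : Type*} (G : SimpleGraph V) (v : V) (r : ℕ) (u : V)
    (hu : u ∈ ballSet G v r) :
    (G.induce (ballSet G v r)).Reachable ⟨v, self_mem_ballSet G v r⟩ ⟨u, hu⟩ := by
  have hne : G.edist v u ≠ ⊤ := ne_top_of_le_ne_top (ENat.natCast_ne_top r) hu
  obtain ⟨p, hp⟩ := SimpleGraph.exists_walk_of_edist_ne_top hne
  have hlen : p.length ≤ r := by
    have h : G.edist v u ≤ r := hu
    rw [← hp] at h
    exact_mod_cast h
  have hsup : ∀ x ∈ p.support, x ∈ ballSet G v r := by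
    intro x hx
    classical
    refine le_trans (SimpleGraph.edist_le (p.takeUntil x hx)) ?_
    exact_mod_cast (p.length_takeUntil_le_length hx).trans hlen
  exact ⟨p.induce _ hsup⟩

/-- The rooted graph `B_r(G, v)`: the subgraph of `G` induced on the vertices at distance at most
`r` from `v`, rooted at `v`. The graph `G` need not be connected. -/
def ballGraph {V : Type} (G : SimpleGraph V) (hG : ∀ v, (G.neighborSet v).Finite) (v : V) (r : ℕ) :
    RootedGraph where
  V := ballSet G v r
  graph := G.induce (ballSet G v r)
  root := ⟨v, self_mem_ballSet G v r⟩
  connected :=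
    { preconnected := fun a b =>
        (ballSet_induce_reachable G v r a.1 a.2).symm.trans
          (ballSet_induce_reachable G v r b.1 b.2)
      nonempty := ⟨⟨v, self_mem_ballSet G v r⟩⟩ }
  locallyFinite := fun u =>
    Set.Finite.of_finite_image
      ((hG u.1).subset (by rintro _ ⟨x, hx, rfl⟩; exact hx)) Subtype.val_injective.injOn

theorem edist_map_le {V W : Type*} {G : SimpleGraph V} {H : SimpleGraph W} (φ : G →g H) (a b : V) :
    H.edist (φ a) (φ b) ≤ G.edist a b := by
  by_cases h : G.edist a b = ⊤
  · simp [h]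
  · obtain ⟨p, hp⟩ := SimpleGraph.exists_walk_of_edist_ne_top h
    rw [← hp, ← SimpleGraph.Walk.length_map φ p]
    exact SimpleGraph.edist_le _

theorem edist_iso {V W : Type*} {G : SimpleGraph V} {H : SimpleGraph W} (φ : G ≃g H) (a b : V) :
    H.edist (φ a) (φ b) = G.edist a b := by
  refine le_antisymm (edist_map_le φ.toHom a b) ?_
  have h := edist_map_le φ.symm.toHom (φ a) (φ b)
  have e : ∀ x, φ.symm.toHom (φ x) = x := fun x => φ.symm_apply_apply x
  rwa [e, e] at h

theorem RootedIso.ball {V W : Type*} {G : SimpleGraph V} {v : V} {H : SimpleGraph W} {w : W}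
    (h : RootedIso G v H w) (r : ℕ) :
    RootedIso (G.induce (ballSet G v r)) ⟨v, self_mem_ballSet G v r⟩
      (H.induce (ballSet H w r)) ⟨w, self_mem_ballSet H w r⟩ := by
  obtain ⟨φ, rfl⟩ := h
  refine ⟨⟨φ.toEquiv.subtypeEquiv fun a => ?_, fun {a b} => ?_⟩, rfl⟩
  · change G.edist v a ≤ r ↔ H.edist (φ v) (φ a) ≤ r
    rw [edist_iso]
  · exact φ.map_rel_iff (a := a.1) (b := b.1)

namespace GStar

/-- The map `B_r` on isomorphism classes. -/
def ball (r : ℕ) : GStar → GStar :=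
  Quotient.map (fun G => ballGraph G.graph G.locallyFinite G.root r)
    (fun _ _ h => RootedIso.ball h r)

/-- `d_loc(g, h) = 2 ^ (- sup {r | B_r(g) ≅ B_r(h)})`, written as the infimum of `2 ^ (-r)` over the
`r` with `B_r(g) ≅ B_r(h)`, so that it is `0` when the supremum is infinite. The set of such `r`
contains `0`. -/
noncomputable def dloc (g h : GStar) : ℝ :=
  sInf {x : ℝ | ∃ r : ℕ, ball r g = ball r h ∧ x = (2 : ℝ)⁻¹ ^ r}

/-- The topology of `d_loc`. -/
instance : TopologicalSpace GStar where
  IsOpen U := ∀ g ∈ U, ∃ ε : ℝ, 0 < ε ∧ ∀ h : GStar, dloc g h < ε → h ∈ U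
  isOpen_univ := fun _ _ => ⟨1, one_pos, fun _ _ => trivial⟩
  isOpen_inter := by
    rintro U U' hU hU' g ⟨hg, hg'⟩
    obtain ⟨ε, h0, h1⟩ := hU g hg
    obtain ⟨δ, h2, h3⟩ := hU' g hg'
    exact ⟨min ε δ, lt_min h0 h2, fun h hh =>
      ⟨h1 h (lt_of_lt_of_le hh (min_le_left _ _)), h3 h (lt_of_lt_of_le hh (min_le_right _ _))⟩⟩
  isOpen_sUnion := by
    rintro S hS g ⟨U, hU, hg⟩
    obtain ⟨ε, h0, h1⟩ := hS U hU g hg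
    exact ⟨ε, h0, fun h hh => ⟨U, hU, h1 h hh⟩⟩

/-- The Borel σ-algebra of `d_loc`. -/
instance : MeasurableSpace GStar := borel GStar

instance : BorelSpace GStar := ⟨rfl⟩

/-- The degree of the root. -/
noncomputable def rootDeg : GStar → ℕ :=
  Quotient.lift (fun G => deg G.graph G.root) (by
    rintro G H ⟨φ, hφ⟩
    change (G.graph.neighborSet G.root).ncard = (H.graph.neighborSet H.root).ncard
    rw [← hφ, ← Set.ncard_image_of_injective _ φ.injective]
    congr 1
    ext y
    obtain ⟨x, rfl⟩ := φ.surjective y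
    simp [φ.injective.eq_iff, φ.map_adj_iff])

/-- The number of embeddings of the graph `H` rooted at `w` that map `w` to the root. -/
noncomputable def emb {W : Type*} (H : SimpleGraph W) (w : W) : GStar → ℕ :=
  Quotient.lift (fun G => embRooted H w G.graph G.root) (by
    rintro G K ⟨φ, hφ⟩
    refine Nat.card_congr
      ⟨fun f => ⟨φ.toCopy.comp f.1, ?_⟩, fun f => ⟨φ.symm.toCopy.comp f.1, ?_⟩, ?_, ?_⟩
    · have h := f.2
      change φ (f.1 w) = K.root
      rw [h, hφ]
    · have h := f.2
      change φ.symm (f.1 w) = G.root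
      rw [h, ← hφ]
      exact φ.symm_apply_apply _
    · intro f
      apply Subtype.ext
      apply DFunLike.ext
      intro x
      exact φ.symm_apply_apply _
    · intro f
      apply Subtype.ext
      apply DFunLike.ext
      intro x
      exact φ.apply_symm_apply _)

end GStar

/-! ### Random graphs -/

/-- `p_r(G, H)`: the proportion of the vertices `v` of the finite graph `G` with
`B_r(G, v) ≅ H`. -/
noncomputable def ballFreq {V : Type} [Fintype V] (G : SimpleGraph V) (r : ℕ) (H : RootedGraph) :
    ℝ :=
  ({v : V | ballGraph G (fun _ => Set.toFinite _) v r ≈ H}.ncard : ℝ) / Fintype.card V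

/-- Convergence in probability of random variables `X n`, each on its own probability space, to the
constant `c`. -/
def TendstoInProb {Ω : ℕ → Type*} [∀ n, MeasurableSpace (Ω n)] (P : ∀ n, Measure (Ω n))
    (X : ∀ n, Ω n → ℝ) (c : ℝ) : Prop :=
  ∀ ε : ℝ, 0 < ε → Tendsto (fun n => P n {ω | ε ≤ |X n ω - c|}) atTop (𝓝 0)

/-- Local weak convergence in probability of the finite random graphs `G n` to a random element of
`GStar` with law `μ`. -/
def TendstoLocallyInProb {Ω : ℕ → Type*} [∀ n, MeasurableSpace (Ω n)] (P : ∀ n, Measure (Ω n))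
    {V : ℕ → Type} [∀ n, Fintype (V n)] (G : ∀ n, Ω n → SimpleGraph (V n))
    (μ : Measure GStar) : Prop :=
  ∀ (r : ℕ) (H : RootedGraph), Finite H.V →
    TendstoInProb P (fun n ω => ballFreq (G n ω) r H)
      (μ.real {g | GStar.ball r g = Quotient.mk _ H})

/-- The expectation of the `k`-th power of the degree of a vertex chosen uniformly at random,
independently of everything else, from the vertex set of the random graph `G`. -/
noncomputable def degreeMoment {Ω : Type*} [MeasurableSpace Ω] (P : Measure Ω) {V : Type}
    (G : Ω → SimpleGraph V) (k : ℕ) : ℝ :=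
  letI : MeasurableSpace V := ⊤
  ∫ p : Ω × V, (deg (G p.1) p.2 : ℝ) ^ k ∂(P.prod (uniformOn Set.univ))

/-- The clustering coefficient of a finite graph: the number of embeddings of the triangle over the
number of embeddings of the path on three vertices (`0` when the denominator is zero). -/
noncomputable def clusteringCoeff {V : Type} [Fintype V] (G : SimpleGraph V) : ℝ :=
  (G.labelledCopyCount (SimpleGraph.completeGraph (Fin 3)) : ℝ) /
    (G.labelledCopyCount (SimpleGraph.pathGraph 3) : ℝ)

/-- Rooted embeddings of the triangle, rooted at any vertex. -/
noncomputable def embTriangle (g : GStar) : ℕ :=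
  GStar.emb (SimpleGraph.completeGraph (Fin 3)) 0 g

/-- Rooted embeddings of the star with two leaves, rooted at its vertex of degree two. -/
noncomputable def embCherry (g : GStar) : ℕ :=
  GStar.emb (completeBipartiteGraph (Fin 1) (Fin 2)) (Sum.inl 0) g

end LocalWeak

namespace LocalWeak

/-! ### Unit balls -/

/-! Counting triangles by the image of one vertex and paths by the image of the middle vertex turns
the clustering coefficient into a ratio of two vertex averages (`clusteringCoeff_eq`). The averaged
functions, rooted triangles and `(deg)_2`, depend only on the unit ball and lie between `0` and
`deg²`.

The core is `TendstoLocallyInProb.vertexAvg`: for every such function `f`, the average over the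
vertices converges in probability to `∫ f ∂μ`. Unit balls fall into countably many classes
(`countable_finiteClasses`), so a finite set `S` of classes carries all but a small part of `∫
deg²`. On `S` the average is a finite linear combination of ball frequencies, and local convergence
applies. Off `S` it is dominated by the average of `deg²`. Convergence of the second moments makes
the expectation of that tail converge to the tail of the limit, and Markov's inequality makes it
small with high probability.

Numerator and denominator then converge separately, and division is continuous where the limiting
denominator is nonzero. -/

theorem mem_ballSet_one {V : Type*} {G : SimpleGraph V} {v u : V} :
    u ∈ ballSet G v 1 ↔ G.Adj v u ∨ v = u := by
  simp [ballSet, SimpleGraph.edist_le_one_iff_adj_or_eq]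

theorem ballSet_mono {V : Type*} (G : SimpleGraph V) (v : V) {r s : ℕ} (h : r ≤ s) :
    ballSet G v r ⊆ ballSet G v s :=
  fun u hu => by
    have hu' : G.edist v u ≤ r := hu
    exact hu'.trans (by exact_mod_cast h)

theorem ballSet_one_finite {V : Type*} (G : SimpleGraph V) (v : V)
    (h : (G.neighborSet v).Finite) : (ballSet G v 1).Finite :=
  (h.insert v).subset fun _ hu =>
    (mem_ballSet_one.1 hu).elim (fun h => Or.inr h) (fun h => Or.inl h.symm)

/-- Distance at most one means adjacency or equality, and an induced subgraph preserves both; for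
larger radii geodesics would have to be tracked. -/
theorem GStar.ball_one_ball {s : ℕ} (hs : 1 ≤ s) (g : GStar) : ball 1 (ball s g) = ball 1 g := by
  induction g using Quotient.ind with
  | _ G =>
    refine Quotient.sound ⟨⟨⟨fun u => ⟨u.1.1, ?_⟩,
      fun u => ⟨⟨u.1, ballSet_mono _ _ hs u.2⟩, ?_⟩, fun u => ?_, fun u => ?_⟩, ?_⟩, ?_⟩
    · rcases mem_ballSet_one.1 u.2 with h | h
      · exact mem_ballSet_one.2 (Or.inl h)
      · exact mem_ballSet_one.2 (Or.inr (congrArg Subtype.val h))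
    · rcases mem_ballSet_one.1 u.2 with h | h
      · exact mem_ballSet_one.2 (Or.inl h)
      · exact mem_ballSet_one.2 (Or.inr (Subtype.ext h))
    · rfl
    · rfl
    · exact Iff.rfl
    · rfl

theorem deg_induce_ballSet_one {V : Type*} (G : SimpleGraph V) (v : V) :
    deg (G.induce (ballSet G v 1)) ⟨v, self_mem_ballSet G v 1⟩ = deg G v := by
  unfold deg
  rw [← Set.ncard_image_of_injective _ Subtype.val_injective]
  congr 1
  ext u
  constructor
  · rintro ⟨x, hx, rfl⟩
    exact hx
  · intro hu
    exact ⟨⟨u, mem_ballSet_one.2 (Or.inl hu)⟩, hu, rfl⟩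

/-- Since every vertex of `H` is `w` or a neighbour of `w`, an embedding rooted at `v` cannot leave
the unit ball. -/
theorem embRooted_induce_ballSet_one {W V : Type*} (H : SimpleGraph W) (w : W)
    (hw : ∀ x, x = w ∨ H.Adj w x) (G : SimpleGraph V) (v : V) :
    embRooted H w (G.induce (ballSet G v 1)) ⟨v, self_mem_ballSet G v 1⟩ =
      embRooted H w G v := by
  refine Nat.card_congr ⟨fun f => ⟨(SimpleGraph.Copy.induce G _).comp f.1, ?_⟩,
    fun f => ⟨⟨⟨fun x => ⟨f.1 x, ?_⟩, fun {a b} h => f.1.toHom.map_adj h⟩, fun a b h =>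
      f.1.injective (congrArg Subtype.val h)⟩, ?_⟩, fun f => ?_, fun f => ?_⟩
  · change (f.1 w).1 = v
    rw [f.2]
  · rcases hw x with rfl | h
    · rw [f.2]; exact self_mem_ballSet G v 1
    · refine mem_ballSet_one.2 (Or.inl ?_)
      have := f.1.toHom.map_adj h
      change G.Adj (f.1 w) (f.1 x) at this
      rwa [f.2] at this
  · exact Subtype.ext f.2
  · rfl
  · rfl

theorem GStar.rootDeg_ball_one (g : GStar) : (ball 1 g).rootDeg = g.rootDeg := by
  induction g using Quotient.ind with
  | _ G => exact deg_induce_ballSet_one G.graph G.root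

theorem embTriangle_ball_one (g : GStar) : embTriangle (g.ball 1) = embTriangle g := by
  induction g using Quotient.ind with
  | _ G =>
    refine embRooted_induce_ballSet_one _ _ (fun x => ?_) G.graph G.root
    rcases eq_or_ne x 0 with h | h
    · exact Or.inl h
    · exact Or.inr h.symm

/-! ### Counting rooted cherries and triangles -/

/-- A rooted cherry is an ordered pair of distinct neighbours of `v`. -/
theorem embRooted_cherry {V : Type*} (G : SimpleGraph V) (v : V)
    (hv : (G.neighborSet v).Finite) :
    embRooted (completeBipartiteGraph (Fin 1) (Fin 2)) (Sum.inl 0) G v =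
      (deg G v).descFactorial 2 := by
  classical
  have := hv.fintype
  have e : {f : SimpleGraph.Copy (completeBipartiteGraph (Fin 1) (Fin 2)) G // f (Sum.inl 0) = v} ≃
      (Fin 2 ↪ G.neighborSet v) :=
    { toFun := fun f => ⟨fun i => ⟨f.1 (Sum.inr i), by
          have h : (completeBipartiteGraph (Fin 1) (Fin 2)).Adj (Sum.inl 0) (Sum.inr i) := by simp
          have h' : G.Adj (f.1 (Sum.inl 0)) (f.1 (Sum.inr i)) := f.1.toHom.map_adj h
          rwa [f.2] at h'⟩, fun i j h =>
            Sum.inr_injective (f.1.injective (congrArg Subtype.val h))⟩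
      invFun := fun e => ⟨⟨⟨Sum.elim (fun _ => v) (fun i => (e i).1), by
          rintro (a | a) (b | b) h
          · simp at h
          · exact (e b).2
          · exact ((e a).2 : G.Adj v (e a).1).symm
          · simp at h⟩, by
          rintro (a | a) (b | b) h
          · rw [Subsingleton.elim a b]
          · exact absurd h ((e b).2 : G.Adj v (e b).1).ne
          · exact absurd h.symm ((e a).2 : G.Adj v (e a).1).ne
          · exact congrArg Sum.inr (e.injective (Subtype.ext h))⟩, rfl⟩
      left_inv := fun f => by
        apply Subtype.ext
        apply DFunLike.ext
        rintro (a | a)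
        · rw [Subsingleton.elim a 0]; exact f.2.symm
        · rfl
      right_inv := fun e => by ext; rfl }
  rw [embRooted, Nat.card_congr e, Nat.card_eq_fintype_card, Fintype.card_embedding_eq,
    Fintype.card_fin, deg, Set.ncard_eq_toFinset_card', Set.toFinset_card]

theorem embCherry_eq (g : GStar) : embCherry g = g.rootDeg.descFactorial 2 := by
  induction g using Quotient.ind with
  | _ G => exact embRooted_cherry G.graph G.root (G.locallyFinite _)

/-- The cherry, viewed in the triangle. -/
def cherryToTriangle : SimpleGraph.Copy (completeBipartiteGraph (Fin 1) (Fin 2))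
    (SimpleGraph.completeGraph (Fin 3)) :=
  ⟨⟨Sum.elim (fun _ => 0) Fin.succ, by
    rintro (a | a) (b | b) h
    · simp at h
    · exact (Fin.succ_ne_zero b).symm
    · exact Fin.succ_ne_zero a
    · simp at h⟩, by
    rintro (a | a) (b | b) h
    · rw [Subsingleton.elim a b]
    · exact absurd h (Fin.succ_ne_zero b).symm
    · exact absurd h (Fin.succ_ne_zero a)
    · exact congrArg Sum.inr (Fin.succ_injective _ h)⟩

theorem cherryToTriangle_surjective : Function.Surjective cherryToTriangle := by
  intro x
  induction x using Fin.cases with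
  | zero => exact ⟨Sum.inl 0, rfl⟩
  | succ i => exact ⟨Sum.inr i, rfl⟩

/-- Restriction along `cherryToTriangle` loses nothing, because the cherry already spans all three
vertices. -/
theorem embRooted_triangle_le {V : Type*} (G : SimpleGraph V) (v : V)
    (hv : (G.neighborSet v).Finite) :
    embRooted (SimpleGraph.completeGraph (Fin 3)) 0 G v ≤
      embRooted (completeBipartiteGraph (Fin 1) (Fin 2)) (Sum.inl 0) G v := by
  have hB := ballSet_one_finite G v hv
  have := hB.to_subtype
  -- `Nat.card` is `0` on infinite types, so the comparison needs a finite target; inside the unit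
  -- ball there are only finitely many copies.
  rw [← embRooted_induce_ballSet_one (completeBipartiteGraph (Fin 1) (Fin 2)) (Sum.inl 0)
      (by rintro (x | x); exacts [Or.inl (by rw [Subsingleton.elim x 0]), Or.inr (by simp)]),
    ← embRooted_induce_ballSet_one (SimpleGraph.completeGraph (Fin 3)) 0
      (fun x => (eq_or_ne x 0).imp_right fun h => h.symm)]
  have : Finite (SimpleGraph.Copy (completeBipartiteGraph (Fin 1) (Fin 2))
      (G.induce (ballSet G v 1))) := DFunLike.finite _
  refine Nat.card_le_card_of_injective
    (fun f => ⟨f.1.comp cherryToTriangle, f.2⟩) fun f g h => ?_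
  apply Subtype.ext
  apply DFunLike.ext
  intro x
  obtain ⟨y, rfl⟩ := cherryToTriangle_surjective x
  exact DFunLike.congr_fun (congrArg Subtype.val h) y

theorem embTriangle_le (g : GStar) : embTriangle g ≤ embCherry g := by
  induction g using Quotient.ind with
  | _ G => exact embRooted_triangle_le G.graph G.root (G.locallyFinite _)

theorem labelledCopyCount_eq_sum {W V : Type*} [Fintype W] [Fintype V] (H : SimpleGraph W) (w : W)
    (G : SimpleGraph V) : G.labelledCopyCount H = ∑ v, embRooted H w G v := by
  classical
  have : Finite (SimpleGraph.Copy H G) := DFunLike.finite _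
  have h : G.labelledCopyCount H = Nat.card (SimpleGraph.Copy H G) := by
    rw [SimpleGraph.labelledCopyCount, Nat.card_eq_fintype_card]
  rw [h, Nat.card_congr (Equiv.sigmaFiberEquiv fun f : SimpleGraph.Copy H G => f w).symm,
    Nat.card_sigma]
  rfl

theorem embRooted_congr_left {W X V : Type*} {H : SimpleGraph W} {K : SimpleGraph X} (φ : H ≃g K)
    (w : W) (G : SimpleGraph V) (v : V) : embRooted H w G v = embRooted K (φ w) G v := by
  refine Nat.card_congr ⟨fun f => ⟨f.1.comp φ.symm.toCopy, ?_⟩, fun f => ⟨f.1.comp φ.toCopy, f.2⟩,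
    fun f => ?_, fun f => ?_⟩
  · change f.1 (φ.symm (φ w)) = v
    rw [φ.symm_apply_apply, f.2]
  · apply Subtype.ext
    apply DFunLike.ext
    intro x
    exact congrArg f.1 (φ.symm_apply_apply x)
  · apply Subtype.ext
    apply DFunLike.ext
    intro x
    exact congrArg f.1 (φ.apply_symm_apply x)

/-- The star with two leaves is the path on three vertices. -/
def cherryIsoPath : completeBipartiteGraph (Fin 1) (Fin 2) ≃g SimpleGraph.pathGraph 3 where
  toFun := Sum.elim (fun _ => 1) ![0, 2]
  invFun := ![Sum.inr 0, Sum.inl 0, Sum.inr 1]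
  left_inv := by decide
  right_inv := by decide
  map_rel_iff' := by
    rintro (a | a) (b | b) <;> fin_cases a <;> fin_cases b <;>
      simp [SimpleGraph.pathGraph_adj]

theorem labelledCopyCount_pathGraph {V : Type*} [Fintype V] (G : SimpleGraph V) :
    G.labelledCopyCount (SimpleGraph.pathGraph 3) = ∑ v, (deg G v).descFactorial 2 := by
  rw [labelledCopyCount_eq_sum _ (cherryIsoPath (Sum.inl 0))]
  refine Finset.sum_congr rfl fun v _ => ?_
  rw [← embRooted_congr_left, embRooted_cherry G v (Set.toFinite _)]

/-! ### Averages over the vertices of a finite graph -/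

/-- The isomorphism class of `B_1(G, v)`. -/
def unitBall {V : Type} [Finite V] (G : SimpleGraph V) (v : V) : GStar :=
  Quotient.mk _ (ballGraph G (fun _ => Set.toFinite _) v 1)

/-- The average over the vertices `v` of a finite graph `G` of `f (B_1(G, v))`. -/
noncomputable def vertexAvg {V : Type} [Fintype V] (G : SimpleGraph V) (f : GStar → ℝ) : ℝ :=
  (∑ v, f (unitBall G v)) / Fintype.card V

theorem rootDeg_unitBall {V : Type} [Finite V] (G : SimpleGraph V) (v : V) :
    (unitBall G v).rootDeg = deg G v :=
  deg_induce_ballSet_one G v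

theorem embTriangle_unitBall {V : Type} [Finite V] (G : SimpleGraph V) (v : V) :
    embTriangle (unitBall G v) = embRooted (SimpleGraph.completeGraph (Fin 3)) 0 G v :=
  embRooted_induce_ballSet_one _ _ (fun x => (eq_or_ne x 0).imp_right fun h => h.symm) G v

/-- The factors `1 / |V|` cancel. A vanishing path count gives division by zero on both sides, hence
`0`, so no case distinction is needed. -/
theorem clusteringCoeff_eq {V : Type} [Fintype V] [Nonempty V] (G : SimpleGraph V) :
    clusteringCoeff G = vertexAvg G (fun g => (embTriangle g : ℝ)) /
      vertexAvg G (fun g => (g.rootDeg.descFactorial 2 : ℝ)) := by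
  have hV : (Fintype.card V : ℝ) ≠ 0 := by exact_mod_cast Fintype.card_ne_zero
  unfold clusteringCoeff vertexAvg
  rw [div_div_div_cancel_right₀ hV, labelledCopyCount_eq_sum _ 0, labelledCopyCount_pathGraph]
  simp only [embTriangle_unitBall, rootDeg_unitBall, Nat.cast_sum]

theorem ballFreq_one {V : Type} [Fintype V] (G : SimpleGraph V) (H : RootedGraph) :
    ballFreq G 1 H = vertexAvg G (Set.indicator {Quotient.mk _ H} 1) := by
  classical
  unfold ballFreq vertexAvg
  congr 1
  have h : {v : V | ballGraph G (fun _ => Set.toFinite _) v 1 ≈ H} =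
      ((Finset.univ.filter fun v => unitBall G v = Quotient.mk _ H : Finset V) : Set V) := by
    ext v
    rw [Finset.coe_filter]
    exact ⟨fun h => ⟨Finset.mem_univ v, Quotient.sound h⟩, fun h => Quotient.exact h.2⟩
  rw [h, Set.ncard_coe_finset, Finset.card_filter]
  push_cast
  refine Finset.sum_congr rfl fun v _ => ?_
  rw [Set.indicator_apply]
  rfl

/-! ### Classes of unit balls -/

/-- The isomorphism classes of finite rooted graphs. -/
def finiteClasses : Set GStar :=
  {q | ∃ H : RootedGraph, Finite H.V ∧ (Quotient.mk _ H : GStar) = q}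

theorem ball_one_mem_finiteClasses (g : GStar) : g.ball 1 ∈ finiteClasses := by
  induction g using Quotient.ind with
  | _ G => exact ⟨_, (ballSet_one_finite G.graph G.root (G.locallyFinite _)).to_subtype, rfl⟩

/-- Every finite rooted graph has a copy on some `Fin n`, which leaves finitely many choices of
edges and root for each `n`. -/
theorem countable_finiteClasses : finiteClasses.Countable := by
  have h : finiteClasses ⊆ ⋃ (n : ℕ) (K : SimpleGraph (Fin n)) (v : Fin n),
      {q | ∃ H : RootedGraph, RootedIso K v H.graph H.root ∧ (Quotient.mk _ H : GStar) = q} := by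
    rintro _ ⟨H, hH, rfl⟩
    obtain ⟨n, ⟨e⟩⟩ := Finite.exists_equiv_fin H.V
    refine Set.mem_iUnion.2 ⟨n, Set.mem_iUnion.2 ⟨H.graph.map e.toEmbedding,
      Set.mem_iUnion.2 ⟨e H.root, H, RootedIso.symm ⟨SimpleGraph.Iso.map e H.graph, rfl⟩, rfl⟩⟩⟩
  refine Set.Countable.mono h ?_
  refine Set.countable_iUnion fun n => Set.countable_iUnion fun K => Set.countable_iUnion fun v =>
    Set.Subsingleton.countable ?_
  rintro _ ⟨H, hH, rfl⟩ _ ⟨H', hH', rfl⟩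
  exact Quotient.sound (hH.symm.trans hH')

theorem GStar.ball_one_eq_of_dloc_lt {g h : GStar} (hd : dloc g h < 2⁻¹) : ball 1 g = ball 1 h := by
  -- Balls of radius `0` are single points, so `r = 0` always qualifies. Without this the real
  -- `sInf` could be the default value `0` of the empty set.
  have hne : {x : ℝ | ∃ r : ℕ, ball r g = ball r h ∧ x = (2 : ℝ)⁻¹ ^ r}.Nonempty := by
    by_contra hn
    rw [Set.not_nonempty_iff_eq_empty] at hn
    have h0 : ball 0 g ≠ ball 0 h := fun h0 =>
      (Set.ext_iff.1 hn _).1 ⟨0, h0, rfl⟩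
    apply h0
    clear hd hn h0
    induction g using Quotient.ind with
    | _ G =>
    induction h using Quotient.ind with
    | _ H =>
      have key : ∀ K : RootedGraph, ∀ u : ballSet K.graph K.root 0,
          u = ⟨K.root, self_mem_ballSet _ _ _⟩ := by
        rintro K ⟨u, hu⟩
        apply Subtype.ext
        have : K.graph.edist K.root u ≤ 0 := hu
        exact (SimpleGraph.edist_eq_zero_iff.1 (le_antisymm this bot_le)).symm
      refine Quotient.sound ⟨⟨⟨fun _ => ⟨H.root, self_mem_ballSet _ _ _⟩,
        fun _ => ⟨G.root, self_mem_ballSet _ _ _⟩, fun u => (key G u).symm,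
        fun u => (key H u).symm⟩, fun {a b} => ?_⟩, rfl⟩
      change H.graph.Adj H.root H.root ↔ G.graph.Adj a.1 b.1
      rw [key G a, key G b]
      simp
  obtain ⟨_, ⟨r, hr, rfl⟩, hlt⟩ := exists_lt_of_csInf_lt hne hd
  have hr1 : 1 ≤ r := by
    by_contra h0
    have : r = 0 := by omega
    subst this
    norm_num at hlt
  rw [← ball_one_ball hr1 g, hr, ball_one_ball hr1 h]

/-- Points at distance below `1/2` share their unit ball, so any condition on the unit ball is open,
with no assumption on `A`. -/
theorem measurableSet_ball_one_preimage (A : Set GStar) :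
    MeasurableSet (GStar.ball 1 ⁻¹' A) := by
  refine IsOpen.measurableSet fun g hg => ⟨2⁻¹, by norm_num, fun h hh => ?_⟩
  rw [Set.mem_preimage, ← GStar.ball_one_eq_of_dloc_lt hh]
  exact hg

theorem measurable_comp_ball_one {β : Type*} [MeasurableSpace β] (f : GStar → β) :
    Measurable fun g => f (GStar.ball 1 g) :=
  fun s _ => measurableSet_ball_one_preimage (f ⁻¹' s)

/-! ### Convergence in probability -/

section TendstoInProb

variable {Ω : ℕ → Type*} [∀ n, MeasurableSpace (Ω n)] {P : ∀ n, Measure (Ω n)}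

theorem tendstoInProb_of_subset_union {X : ∀ n, Ω n → ℝ} {c : ℝ}
    (h : ∀ ε : ℝ, 0 < ε → ∃ A B : ∀ n, Set (Ω n),
      (∀ n, {ω | ε ≤ |X n ω - c|} ⊆ A n ∪ B n) ∧
      Tendsto (fun n => P n (A n)) atTop (𝓝 0) ∧ Tendsto (fun n => P n (B n)) atTop (𝓝 0)) :
    TendstoInProb P X c := by
  intro ε hε
  obtain ⟨A, B, hsub, hA, hB⟩ := h ε hε
  have hAB := hA.add hB
  rw [add_zero] at hAB
  exact tendsto_of_tendsto_of_tendsto_of_le_of_le tendsto_const_nhds hAB (fun _ => zero_le)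
    fun n => (measure_mono (hsub n)).trans (measure_union_le _ _)

theorem TendstoInProb.map₂ {X Y : ∀ n, Ω n → ℝ} {a b : ℝ} (hX : TendstoInProb P X a)
    (hY : TendstoInProb P Y b) {F : ℝ × ℝ → ℝ} (hF : ContinuousAt F (a, b)) :
    TendstoInProb P (fun n ω => F (X n ω, Y n ω)) (F (a, b)) := by
  refine tendstoInProb_of_subset_union fun ε hε => ?_
  obtain ⟨δ, hδ, h⟩ := Metric.continuousAt_iff.1 hF ε hε
  refine ⟨_, _, fun n ω hω => ?_, hX δ hδ, hY δ hδ⟩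
  by_contra hn
  simp only [Set.mem_union, Set.mem_ofPred_eq, not_or, not_le] at hn
  have : dist (X n ω, Y n ω) (a, b) < δ := by
    rw [Prod.dist_eq]
    exact max_lt hn.1 hn.2
  exact absurd (h this) (not_lt.2 hω)

theorem tendstoInProb_const (c : ℝ) : TendstoInProb P (fun _ _ => c) c := by
  intro ε hε
  simp [not_le.2 hε]

theorem TendstoInProb.sum_const_mul {ι : Type*} (s : Finset ι) {X : ι → ∀ n, Ω n → ℝ} {c : ι → ℝ}
    (a : ι → ℝ) (h : ∀ i ∈ s, TendstoInProb P (X i) (c i)) :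
    TendstoInProb P (fun n ω => ∑ i ∈ s, a i * X i n ω) (∑ i ∈ s, a i * c i) := by
  classical
  induction s using Finset.induction_on with
  | empty => simpa using tendstoInProb_const 0
  | insert i s hi ih =>
    simp only [Finset.sum_insert hi]
    exact (h i (Finset.mem_insert_self i s)).map₂
      (ih fun j hj => h j (Finset.mem_insert_of_mem hj)) (F := fun p => a i * p.1 + p.2)
      (by fun_prop)

variable [∀ n, IsProbabilityMeasure (P n)]

theorem tendstoInProb_iff_real {X : ∀ n, Ω n → ℝ} {c : ℝ} :
    TendstoInProb P X c ↔
      ∀ ε : ℝ, 0 < ε → Tendsto (fun n => (P n).real {ω | ε ≤ |X n ω - c|}) atTop (𝓝 0) := by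
  refine forall₂_congr fun ε _ => ?_
  rw [← ENNReal.tendsto_toReal_iff (fun n => measure_ne_top _ _) ENNReal.zero_ne_top]
  rfl

/-- Bounded convergence with varying probability spaces: split at `|X - c| ≥ ε / 2`, using the bound
`C` on that event and `ε / 2` off it. -/
theorem TendstoInProb.tendsto_integral {X : ∀ n, Ω n → ℝ} {c C : ℝ} (h : TendstoInProb P X c)
    (hm : ∀ n, Measurable (X n)) (hC : ∀ n ω, |X n ω - c| ≤ C) :
    Tendsto (fun n => ∫ ω, X n ω ∂(P n)) atTop (𝓝 c) := by
  have hint : ∀ n, Integrable (fun ω => X n ω - c) (P n) := fun n =>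
    Integrable.of_bound ((hm n).sub_const c).aestronglyMeasurable C (ae_of_all _ (hC n))
  rw [Metric.tendsto_atTop']
  intro ε hε
  have ht := (tendstoInProb_iff_real.1 h (ε / 2) (half_pos hε)).const_mul C
  rw [mul_zero] at ht
  obtain ⟨N, hN⟩ := eventually_atTop.1 (ht.eventually (gt_mem_nhds (half_pos hε)))
  refine ⟨N, fun n hn => ?_⟩
  have hC0 : 0 ≤ C := by
    obtain ⟨ω⟩ := (P n).nonempty_of_neZero
    exact (abs_nonneg _).trans (hC n ω)
  have hs : MeasurableSet {ω | ε / 2 ≤ |X n ω - c|} :=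
    measurableSet_le measurable_const ((hm n).sub_const c).abs
  have e : ∫ ω, X n ω ∂(P n) - c = ∫ ω, (X n ω - c) ∂(P n) := by
    have hX : Integrable (X n) (P n) := by
      refine ((hint n).add (integrable_const c)).congr (ae_of_all _ fun ω => ?_)
      simp
    rw [integral_sub hX (integrable_const c)]
    simp
  rw [Real.dist_eq, e]
  calc |∫ ω, (X n ω - c) ∂(P n)| ≤ ∫ ω, |X n ω - c| ∂(P n) := abs_integral_le_integral_abs
    _ ≤ ∫ ω, ({ω | ε / 2 ≤ |X n ω - c|}.indicator (fun _ => C) ω + ε / 2) ∂(P n) := by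
        refine integral_mono (hint n).abs
          (((integrable_const C).indicator hs).add (integrable_const _)) fun ω => ?_
        by_cases hω : ε / 2 ≤ |X n ω - c|
        · have : ω ∈ {ω | ε / 2 ≤ |X n ω - c|} := hω
          simp only [Set.indicator_of_mem this]
          linarith [hC n ω]
        · have : ω ∉ {ω | ε / 2 ≤ |X n ω - c|} := hω
          simp only [Set.indicator_of_notMem this]
          linarith
    _ = C * (P n).real {ω | ε / 2 ≤ |X n ω - c|} + ε / 2 := by
        rw [integral_add ((integrable_const C).indicator hs) (integrable_const _),
          integral_indicator_const _ hs, smul_eq_mul, mul_comm]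
        simp
    _ < ε := by linarith [hN n hn.le]

end TendstoInProb

/-! ### Functions of a random finite graph -/

/-- On finitely many vertices every set of graphs is measurable: its image under `edgeSet` is a
finite set. -/
theorem measurable_of_finite_graph {V : Type} [Finite V] {β : Type*} [MeasurableSpace β]
    (F : SimpleGraph V → β) : Measurable F := by
  intro s _
  have e := SimpleGraph.measurableEmbedding_edgeSet (V := V)
  rw [← Set.preimage_image_eq (F ⁻¹' s) e.injective]
  exact e.measurable (Set.toFinite _).measurableSet

theorem vertexAvg_add {V : Type} [Fintype V] (G : SimpleGraph V) (f g : GStar → ℝ) :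
    vertexAvg G (fun q => f q + g q) = vertexAvg G f + vertexAvg G g := by
  simp only [vertexAvg, Finset.sum_add_distrib, add_div]

theorem vertexAvg_mono {V : Type} [Fintype V] (G : SimpleGraph V) {f g : GStar → ℝ} (h : f ≤ g) :
    vertexAvg G f ≤ vertexAvg G g := by
  unfold vertexAvg
  gcongr
  exact h _

theorem vertexAvg_nonneg {V : Type} [Fintype V] (G : SimpleGraph V) {f : GStar → ℝ} (h : 0 ≤ f) :
    0 ≤ vertexAvg G f :=
  div_nonneg (Finset.sum_nonneg fun _ _ => h _) (Nat.cast_nonneg _)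

theorem integral_uniformOn_univ {V : Type} [Fintype V] [Nonempty V] [MeasurableSpace V]
    [MeasurableSingletonClass V] (f : V → ℝ) :
    ∫ v, f v ∂(uniformOn (Set.univ : Set V)) = (∑ v, f v) / Fintype.card V := by
  rw [integral_fintype Integrable.of_finite, Finset.sum_div]
  refine Finset.sum_congr rfl fun v _ => ?_
  rw [measureReal_def, uniformOn_univ, Measure.count_singleton, smul_eq_mul]
  simp [div_eq_inv_mul]

theorem degreeMoment_eq {Ω : Type*} [MeasurableSpace Ω] (P : Measure Ω) [IsProbabilityMeasure P]
    {V : Type} [Fintype V] [Nonempty V] {G : Ω → SimpleGraph V} (hG : Measurable G) (k : ℕ) :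
    degreeMoment P G k = ∫ ω, vertexAvg (G ω) (fun q => (q.rootDeg : ℝ) ^ k) ∂P := by
  let m : MeasurableSpace V := ⊤
  have hp : IsProbabilityMeasure (uniformOn (Set.univ : Set V)) :=
    isProbabilityMeasure_uniformOn Set.finite_univ Set.univ_nonempty
  have hm : Measurable fun p : Ω × V => (deg (G p.1) p.2 : ℝ) ^ k :=
    measurable_from_prod_countable_left fun v =>
      (measurable_of_finite_graph fun K => (deg K v : ℝ) ^ k).comp hG
  have hi : Integrable (fun p : Ω × V => (deg (G p.1) p.2 : ℝ) ^ k)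
      (P.prod (uniformOn Set.univ)) := by
    refine Integrable.of_bound hm.aestronglyMeasurable ((Nat.card V : ℝ) ^ k)
      (ae_of_all _ fun p => ?_)
    rw [Real.norm_of_nonneg (by positivity)]
    gcongr
    exact Set.ncard_le_card _
  change ∫ p : Ω × V, (deg (G p.1) p.2 : ℝ) ^ k ∂(P.prod (uniformOn Set.univ)) = _
  rw [integral_prod _ hi]
  simp only [integral_uniformOn_univ, vertexAvg, rootDeg_unitBall]

/-! ### Truncation to finitely many classes -/

theorem integrable_of_le_rootDeg_sq {μ : Measure GStar}
    (hint : Integrable (fun g => (g.rootDeg : ℝ) ^ 2) μ) {f : GStar → ℝ}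
    (hf : ∀ g, f (g.ball 1) = f g) (h0 : ∀ g, 0 ≤ f g) (hle : ∀ g, f g ≤ (g.rootDeg : ℝ) ^ 2) :
    Integrable f μ := by
  have hm : Measurable f := by
    have := measurable_comp_ball_one f
    simpa only [hf] using this
  refine hint.mono' hm.aestronglyMeasurable (ae_of_all _ fun g => ?_)
  rw [Real.norm_of_nonneg (h0 g)]
  exact hle g

theorem integrable_indicator_ball_one {μ : Measure GStar} {f : GStar → ℝ}
    (hf : ∀ g, f (g.ball 1) = f g) (hint : Integrable f μ) (A : Set GStar) :
    Integrable (fun g => A.indicator f (g.ball 1)) μ := by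
  have h : (fun g : GStar => A.indicator f (g.ball 1)) = (GStar.ball 1 ⁻¹' A).indicator f := by
    funext g
    by_cases hg : g.ball 1 ∈ A
    · rw [Set.indicator_of_mem hg, Set.indicator_of_mem (s := GStar.ball 1 ⁻¹' A) hg, hf]
    · rw [Set.indicator_of_notMem hg, Set.indicator_of_notMem (s := GStar.ball 1 ⁻¹' A) hg]
  rw [h]
  exact hint.indicator (measurableSet_ball_one_preimage A)

/-- Exhaust the countably many classes by finite sets; the tails vanish pointwise and are dominated
by `|f|`. -/
theorem exists_finset_integral_compl_lt {μ : Measure GStar} {f : GStar → ℝ}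
    (hf : ∀ g, f (g.ball 1) = f g) (hint : Integrable f μ) {η : ℝ} (hη : 0 < η) :
    ∃ S : Finset GStar, ↑S ⊆ finiteClasses ∧
      ∫ g, (S : Set GStar)ᶜ.indicator f (g.ball 1) ∂μ < η := by
  classical
  by_cases hne : Nonempty GStar
  · obtain ⟨g₀⟩ := hne
    obtain ⟨e, he⟩ := countable_finiteClasses.exists_eq_range ⟨_, ball_one_mem_finiteClasses g₀⟩
    have ht : Tendsto (fun k => ∫ g, (((Finset.range k).image e : Finset GStar) :
        Set GStar)ᶜ.indicator f (g.ball 1) ∂μ) atTop (𝓝 (∫ _, (0 : ℝ) ∂μ)) := by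
      refine tendsto_integral_of_dominated_convergence (fun g => ‖f g‖)
        (fun k => (integrable_indicator_ball_one hf hint _).aestronglyMeasurable) hint.norm
        (fun k => ae_of_all _ fun g => ?_) (ae_of_all _ fun g => ?_)
      · exact (norm_indicator_le_norm_self _ _).trans_eq (by rw [hf])
      · obtain ⟨i, hi⟩ : g.ball 1 ∈ Set.range e := he ▸ ball_one_mem_finiteClasses g
        refine tendsto_const_nhds.congr' ?_
        filter_upwards [eventually_gt_atTop i] with k hk
        rw [Set.indicator_of_notMem]
        rw [Set.mem_compl_iff, not_not, ← hi]
        exact Finset.mem_coe.2 (Finset.mem_image_of_mem e (Finset.mem_range.2 hk))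
    rw [integral_zero] at ht
    obtain ⟨k, hk⟩ := (ht.eventually (gt_mem_nhds hη)).exists
    refine ⟨_, ?_, hk⟩
    rw [Finset.coe_image, he]
    exact Set.image_subset_range _ _
  -- Enumerating the classes required a point of `GStar`; without one the measure is zero.
  · have := not_nonempty_iff.1 hne
    refine ⟨∅, by simp, ?_⟩
    rwa [Measure.eq_zero_of_isEmpty μ, integral_zero_measure]

theorem indicator_finset_eq_sum {α : Type*} (S : Finset α) (f : α → ℝ) (q : α) :
    (S : Set α).indicator f q = ∑ s ∈ S, f s * ({s} : Set α).indicator 1 q := by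
  classical
  simp only [Set.indicator_apply, Set.mem_singleton_iff, Pi.one_apply, mul_ite, mul_one, mul_zero,
    Finset.sum_ite_eq, Finset.mem_coe]

theorem integral_indicator_finset {μ : Measure GStar} [IsFiniteMeasure μ] (S : Finset GStar)
    (f : GStar → ℝ) :
    ∫ g, (S : Set GStar).indicator f (g.ball 1) ∂μ =
      ∑ s ∈ S, f s * μ.real {g | g.ball 1 = s} := by
  simp only [indicator_finset_eq_sum]
  have h : ∀ s : GStar, (fun g : GStar => ({s} : Set GStar).indicator (1 : GStar → ℝ) (g.ball 1)) =
      {g : GStar | g.ball 1 = s}.indicator (fun _ => 1) := fun s => rfl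
  have hs : ∀ s : GStar, MeasurableSet {g : GStar | g.ball 1 = s} := fun s =>
    measurableSet_ball_one_preimage {s}
  rw [integral_finsetSum]
  · refine Finset.sum_congr rfl fun s _ => ?_
    rw [integral_const_mul, h, integral_indicator_const _ (hs s)]
    simp
  · intro s _
    refine Integrable.const_mul ?_ _
    rw [h]
    exact (integrable_const 1).indicator (hs s)

theorem vertexAvg_indicator_finset {V : Type} [Fintype V] (G : SimpleGraph V) (S : Finset GStar)
    (f : GStar → ℝ) :
    vertexAvg G ((S : Set GStar).indicator f) =
      ∑ s ∈ S, f s * vertexAvg G (({s} : Set GStar).indicator 1) := by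
  simp only [vertexAvg, indicator_finset_eq_sum S]
  rw [Finset.sum_comm, Finset.sum_div]
  refine Finset.sum_congr rfl fun s _ => ?_
  rw [← Finset.mul_sum, mul_div_assoc]

theorem vertexAvg_indicator_add_compl {V : Type} [Fintype V] (G : SimpleGraph V) (A : Set GStar)
    (f : GStar → ℝ) :
    vertexAvg G (A.indicator f) + vertexAvg G (Aᶜ.indicator f) = vertexAvg G f := by
  rw [← vertexAvg_add]
  congr 1
  exact Set.indicator_self_add_compl A f

theorem integral_indicator_add_compl {μ : Measure GStar} {f : GStar → ℝ}
    (hf : ∀ g, f (g.ball 1) = f g) (hint : Integrable f μ) (A : Set GStar) :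
    ∫ g, A.indicator f (g.ball 1) ∂μ + ∫ g, Aᶜ.indicator f (g.ball 1) ∂μ = ∫ g, f g ∂μ := by
  rw [← integral_add (integrable_indicator_ball_one hf hint _)
    (integrable_indicator_ball_one hf hint _)]
  congr 1
  funext g
  rw [← hf g]
  exact congrFun (Set.indicator_self_add_compl A f) _

/-- A bound independent of the graph, which lets convergence in probability of the truncated
averages pass to expectations. -/
theorem vertexAvg_indicator_le {V : Type} [Fintype V] (G : SimpleGraph V) (S : Finset GStar)
    {f : GStar → ℝ} (h0 : 0 ≤ f) :
    vertexAvg G ((S : Set GStar).indicator f) ≤ ∑ s ∈ S, f s := by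
  unfold vertexAvg
  refine div_le_of_le_mul₀ (Nat.cast_nonneg _) (Finset.sum_nonneg fun s _ => h0 s) ?_
  rw [mul_comm, ← nsmul_eq_mul]
  refine Finset.sum_le_card_nsmul _ _ _ fun v _ => ?_
  by_cases hv : unitBall G v ∈ (S : Set GStar)
  · rw [Set.indicator_of_mem hv]
    exact Finset.single_le_sum (f := f) (fun s _ => h0 s) hv
  · rw [Set.indicator_of_notMem hv]
    exact Finset.sum_nonneg fun s _ => h0 s

/-! ### Vertex averages under local convergence -/

section LocalConvergence

variable {Ω : ℕ → Type*} [∀ n, MeasurableSpace (Ω n)] {P : ∀ n, Measure (Ω n)}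
  {V : ℕ → Type} [∀ n, Fintype (V n)]
  {G : ∀ n, Ω n → SimpleGraph (V n)} {μ : Measure GStar}

theorem TendstoLocallyInProb.vertexAvg_indicator [IsFiniteMeasure μ]
    (hconv : TendstoLocallyInProb P G μ) {S : Finset GStar}
    (hS : ↑S ⊆ finiteClasses) (f : GStar → ℝ) :
    TendstoInProb P (fun n ω => vertexAvg (G n ω) ((S : Set GStar).indicator f))
      (∫ g, (S : Set GStar).indicator f (g.ball 1) ∂μ) := by
  rw [integral_indicator_finset]
  simp only [vertexAvg_indicator_finset]
  refine TendstoInProb.sum_const_mul S f fun s hs => ?_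
  obtain ⟨H, hH, rfl⟩ := hS hs
  have h := hconv 1 H hH
  simp only [ballFreq_one] at h
  exact h

variable [∀ n, IsProbabilityMeasure (P n)]

theorem integrable_vertexAvg [∀ n, Nonempty (V n)] (hG : ∀ n, Measurable (G n)) (f : GStar → ℝ)
    (n : ℕ) : Integrable (fun ω => vertexAvg (G n ω) f) (P n) := by
  have hm : Measurable fun K : SimpleGraph (V n) => vertexAvg K f := measurable_of_finite_graph _
  obtain ⟨C, hC⟩ := (Set.finite_range fun K : SimpleGraph (V n) =>
    ‖vertexAvg K f‖).bddAbove
  exact Integrable.of_bound (hm.comp (hG n)).aestronglyMeasurable C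
    (ae_of_all _ fun ω => hC ⟨G n ω, rfl⟩)

/-- No `deg²` mass escapes: the total converges by the moment hypothesis and the part on `S` by
bounded convergence, hence so does their difference. -/
theorem TendstoLocallyInProb.tendsto_integral_vertexAvg_compl [IsFiniteMeasure μ]
    [∀ n, Nonempty (V n)]
    (hconv : TendstoLocallyInProb P G μ) (hG : ∀ n, Measurable (G n))
    (hint : Integrable (fun g => (g.rootDeg : ℝ) ^ 2) μ)
    (hmom : Tendsto (fun n => degreeMoment (P n) (G n) 2) atTop
      (𝓝 (∫ g, (g.rootDeg : ℝ) ^ 2 ∂μ)))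
    {S : Finset GStar} (hS : ↑S ⊆ finiteClasses) :
    Tendsto (fun n => ∫ ω, vertexAvg (G n ω)
        ((S : Set GStar)ᶜ.indicator fun q => (q.rootDeg : ℝ) ^ 2) ∂(P n)) atTop
      (𝓝 (∫ g, (S : Set GStar)ᶜ.indicator (fun q => (q.rootDeg : ℝ) ^ 2) (g.ball 1) ∂μ)) := by
  set D : GStar → ℝ := fun q => (q.rootDeg : ℝ) ^ 2 with hD
  have hD0 : (0 : GStar → ℝ) ≤ D := fun q => sq_nonneg _
  have hDb : ∀ g : GStar, D (g.ball 1) = D g := fun g => by simp only [hD, GStar.rootDeg_ball_one]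
  set c := ∫ g, (S : Set GStar).indicator D (g.ball 1) ∂μ
  have h1 : Tendsto (fun n => ∫ ω, vertexAvg (G n ω) ((S : Set GStar).indicator D) ∂(P n)) atTop
      (𝓝 c) := by
    refine (hconv.vertexAvg_indicator hS D).tendsto_integral (C := ∑ s ∈ S, D s + |c|)
      (fun n => (measurable_of_finite_graph fun K =>
        vertexAvg K ((S : Set GStar).indicator D)).comp (hG n)) fun n ω => ?_
    refine (abs_sub _ _).trans (add_le_add_left ?_ _)
    rw [abs_of_nonneg (vertexAvg_nonneg _ (Set.indicator_nonneg fun q _ => hD0 q))]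
    exact vertexAvg_indicator_le _ S hD0
  have h2 := hmom.sub h1
  rw [← integral_indicator_add_compl hDb hint (S : Set GStar), add_sub_cancel_left] at h2
  refine h2.congr fun n => ?_
  rw [degreeMoment_eq (P n) (hG n), sub_eq_iff_eq_add',
    ← integral_add (integrable_vertexAvg hG _ n) (integrable_vertexAvg hG _ n)]
  simp only [vertexAvg_indicator_add_compl, hD]

theorem TendstoLocallyInProb.vertexAvg [IsFiniteMeasure μ] [∀ n, Nonempty (V n)]
    (hconv : TendstoLocallyInProb P G μ) (hG : ∀ n, Measurable (G n))
    (hint : Integrable (fun g => (g.rootDeg : ℝ) ^ 2) μ)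
    (hmom : Tendsto (fun n => degreeMoment (P n) (G n) 2) atTop
      (𝓝 (∫ g, (g.rootDeg : ℝ) ^ 2 ∂μ)))
    {f : GStar → ℝ} (hf : ∀ g, f (g.ball 1) = f g) (h0 : ∀ g, 0 ≤ f g)
    (hle : ∀ g, f g ≤ (g.rootDeg : ℝ) ^ 2) :
    TendstoInProb P (fun n ω => vertexAvg (G n ω) f) (∫ g, f g ∂μ) := by
  set D : GStar → ℝ := fun q => (q.rootDeg : ℝ) ^ 2 with hD
  have hDb : ∀ g : GStar, D (g.ball 1) = D g := fun g => by simp only [hD, GStar.rootDeg_ball_one]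
  have hfi := integrable_of_le_rootDeg_sq hint hf h0 hle
  rw [tendstoInProb_iff_real]
  intro ε hε
  refine (tendsto_order.2 ⟨fun a ha => Eventually.of_forall fun n =>
    ha.trans_le measureReal_nonneg, fun κ hκ => ?_⟩)
  -- The first bound controls the tail of the limit. The second is what Markov's inequality at level
  -- `ε / 3` needs to give probability below `κ / 2`.
  obtain ⟨S, hS, hlt⟩ := exists_finset_integral_compl_lt hDb hint
    (lt_min (by positivity : 0 < ε / 3) (by positivity : 0 < ε / 3 * (κ / 2)))
  have hcompl : ∀ q, (S : Set GStar)ᶜ.indicator f q ≤ (S : Set GStar)ᶜ.indicator D q := fun q =>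
    Set.indicator_le_indicator (hle q)
  have hμ0 : 0 ≤ ∫ g, (S : Set GStar)ᶜ.indicator f (g.ball 1) ∂μ :=
    integral_nonneg fun g => Set.indicator_nonneg (fun q _ => h0 q) _
  have hμ : ∫ g, (S : Set GStar)ᶜ.indicator f (g.ball 1) ∂μ < ε / 3 :=
    (integral_mono (integrable_indicator_ball_one hf hfi _)
      (integrable_indicator_ball_one hDb hint _) fun g => hcompl _).trans_lt
        (hlt.trans_le (min_le_left _ _))
  filter_upwards [(tendstoInProb_iff_real.1 (hconv.vertexAvg_indicator hS f) (ε / 3)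
      (by positivity)).eventually (gt_mem_nhds (half_pos hκ)),
    (hconv.tendsto_integral_vertexAvg_compl hG hint hmom hS).eventually
      (gt_mem_nhds (hlt.trans_le (min_le_right _ _)))] with n hn1 hn2
  set Y : Ω n → ℝ := fun ω => LocalWeak.vertexAvg (G n ω) ((S : Set GStar)ᶜ.indicator D) with hY
  have hmarkov := mul_meas_ge_le_integral_of_nonneg (μ := P n) (f := Y)
    (ae_of_all _ fun ω => vertexAvg_nonneg _ (Set.indicator_nonneg fun q _ => sq_nonneg _))
    (integrable_vertexAvg hG _ n) (ε / 3)
  have hn3 : (P n).real {ω | ε / 3 ≤ Y ω} < κ / 2 :=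
    lt_of_mul_lt_mul_left (hmarkov.trans_lt hn2) (by positivity)
  refine ((measureReal_mono (s₂ := {ω | ε / 3 ≤ |LocalWeak.vertexAvg (G n ω)
      ((S : Set GStar).indicator f) - ∫ g, (S : Set GStar).indicator f (g.ball 1) ∂μ|} ∪
      {ω | ε / 3 ≤ Y ω}) fun ω hω => ?_).trans
    (measureReal_union_le _ _)).trans_lt (by linarith [add_lt_add hn1 hn3])
  -- Off both events the truncated averages differ from their limit by less than `ε / 3`, and each
  -- of the two tails lies in `[0, ε / 3)`, so the total error is below `ε`.
  by_contra hn
  rw [Set.mem_union, not_or] at hn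
  obtain ⟨ha, hb⟩ := hn
  simp only [Set.mem_ofPred_eq, not_le] at ha hb hω
  rw [← vertexAvg_indicator_add_compl (G n ω) (S : Set GStar) f,
    ← integral_indicator_add_compl hf hfi (S : Set GStar)] at hω
  have hc : LocalWeak.vertexAvg (G n ω) ((S : Set GStar)ᶜ.indicator f) ≤ Y ω :=
    vertexAvg_mono _ hcompl
  have hc0 : 0 ≤ LocalWeak.vertexAvg (G n ω) ((S : Set GStar)ᶜ.indicator f) :=
    vertexAvg_nonneg _ (Set.indicator_nonneg fun q _ => h0 q)
  rw [abs_lt] at ha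
  rcases le_abs.1 hω with h | h <;> linarith [ha.1, ha.2]

end LocalConvergence

end LocalWeak

theorem mainTheorem5
    {Ω : ℕ → Type*} [∀ n, MeasurableSpace (Ω n)]
    (P : ∀ n, Measure (Ω n)) [∀ n, IsProbabilityMeasure (P n)]
    {V : ℕ → Type} [∀ n, Fintype (V n)]
    (hV3 : ∀ n, 3 ≤ Fintype.card (V n))
    (hV : Tendsto (fun n => Fintype.card (V n)) atTop atTop)
    (G : ∀ n, Ω n → SimpleGraph (V n)) (hG : ∀ n, Measurable (G n))
    (μ : Measure LocalWeak.GStar) [IsProbabilityMeasure μ]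
    (hconv : LocalWeak.TendstoLocallyInProb P G μ)
    (hint : Integrable (fun g => (g.rootDeg : ℝ) ^ 2) μ)
    (hpos : 0 < ∫ g, (g.rootDeg : ℝ) ^ 2 ∂μ)
    (hmom : Tendsto (fun n => LocalWeak.degreeMoment (P n) (G n) 2) atTop
      (𝓝 (∫ g, (g.rootDeg : ℝ) ^ 2 ∂μ)))
    (hne : ∫ g, (g.rootDeg.descFactorial 2 : ℝ) ∂μ ≠ 0) :
    Integrable (fun g => (LocalWeak.embTriangle g : ℝ)) μ ∧
    Integrable (fun g => (LocalWeak.embCherry g : ℝ)) μ ∧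
    Integrable (fun g => (g.rootDeg.descFactorial 2 : ℝ)) μ ∧
    LocalWeak.TendstoInProb P (fun n ω => LocalWeak.clusteringCoeff (G n ω))
      ((∫ g, (LocalWeak.embTriangle g : ℝ) ∂μ) / ∫ g, (LocalWeak.embCherry g : ℝ) ∂μ) ∧
    (∫ g, (LocalWeak.embTriangle g : ℝ) ∂μ) / (∫ g, (LocalWeak.embCherry g : ℝ) ∂μ) =
      (∫ g, (LocalWeak.embTriangle g : ℝ) ∂μ) /
        ∫ g, (g.rootDeg.descFactorial 2 : ℝ) ∂μ := by
  have hne' : ∀ n, Nonempty (V n) := fun n => Fintype.card_pos_iff.1 (by have := hV3 n; omega)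
  have hT : ∀ g : LocalWeak.GStar, LocalWeak.embTriangle g ≤ g.rootDeg.descFactorial 2 := fun g =>
    (LocalWeak.embTriangle_le g).trans_eq (LocalWeak.embCherry_eq g)
  have hC : ∀ g : LocalWeak.GStar, (g.rootDeg.descFactorial 2 : ℝ) ≤ (g.rootDeg : ℝ) ^ 2 :=
    fun g => by exact_mod_cast Nat.descFactorial_le_pow g.rootDeg 2
  have hTb : ∀ g : LocalWeak.GStar,
      (LocalWeak.embTriangle (g.ball 1) : ℝ) = LocalWeak.embTriangle g := fun g => by
    rw [LocalWeak.embTriangle_ball_one]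
  have hCb : ∀ g : LocalWeak.GStar, ((g.ball 1).rootDeg.descFactorial 2 : ℝ) =
      g.rootDeg.descFactorial 2 := fun g => by rw [LocalWeak.GStar.rootDeg_ball_one]
  have hTD : ∀ g : LocalWeak.GStar, (LocalWeak.embTriangle g : ℝ) ≤ (g.rootDeg : ℝ) ^ 2 :=
    fun g => (Nat.cast_le.2 (hT g)).trans (hC g)
  have iT : Integrable (fun g => (LocalWeak.embTriangle g : ℝ)) μ :=
    LocalWeak.integrable_of_le_rootDeg_sq hint hTb (fun _ => Nat.cast_nonneg _) hTD
  have iC : Integrable (fun g => (g.rootDeg.descFactorial 2 : ℝ)) μ :=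
    LocalWeak.integrable_of_le_rootDeg_sq hint hCb (fun _ => Nat.cast_nonneg _) hC
  simp only [LocalWeak.embCherry_eq]
  refine ⟨iT, iC, iC, ?_, trivial⟩
  simp only [LocalWeak.clusteringCoeff_eq]
  -- The nonvanishing of `E (d^*)_2` enters only here, as continuity of the quotient at the limit
  -- point.
  exact (hconv.vertexAvg hG hint hmom hTb (fun _ => Nat.cast_nonneg _) hTD).map₂
    (hconv.vertexAvg hG hint hmom hCb (fun _ => Nat.cast_nonneg _) hC) (F := fun p => p.1 / p.2)
    (continuousAt_fst.div continuousAt_snd hne)
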